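/- Let $H$ be a complex Hilbert space with inner product $(\cdot,\cdot)$ and let $A$ be a self-adjoint operator in $H$ with dense domain that is positive definite: $(Ax,x)\ge a_0\|x\|^2$ on $\mathrm{Dom}(A)$ for some $a_0>0$. Let $H_1=\mathrm{Dom}(A^{1/2})$ with norm $\|x\|_1=\|A^{1/2}x\|$, let $H_{-1}$ be the completion of $H$ in the norm $\|x\|_{-1}=\|A^{-1/2}x\|$, identified with the space of bounded conjugate-linear functionals on $H_1$ through the pairing $(\cdot,\cdot)_{-1,1}$ that extends $(\cdot,\cdot)$, and regard $A$ as a bounded operator $H_1\to H_{-1}$. Let $D:H_1\to H_{-1}$ be a bounded linear operator, with norm $\|D\|$, that is accretive and sectorial: $\mathrm{Re}(Dx,x)_{-1,1}\ge 0$ and $|\mathrm{Im}(Dx,x)_{-1,1}|\le\nu\,\mathrm{Re}(Dx,x)_{-1,1}$ for all $x\in H_1$ and some $\nu>0$. Put $$\alpha=\inf_{0\ne x\in H_1}\frac{\mathrm{Re}(Dx,x)_{-1,1}}{\|x\|_{-1}^2},\quad \beta=\inf_{0\ne x\in H_1}\frac{\mathrm{Re}(Dx,x)_{-1,1}}{\|x\|^2},\quad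 \delta=\inf_{0\ne x\in H_1}\frac{\mathrm{Re}(Dx,x)_{-1,1}}{\|x\|_1^2},$$ assume that $\delta>0$ (in particular $H\neq\{0\}$), and put $$\omega=\left(\frac1\beta+\frac{2}{\sqrt{\alpha\delta}}+\frac{\|D\|^2}{2\delta}+\sqrt{\frac{4\|D\|^2}{\delta\sqrt{\alpha\delta}}+\frac{\|D\|^4}{\delta^2}}\right)^{-1}.$$ Then $\omega>0$, and there is a constant $C>0$ (depending on $A$ and $D$, but not on the initial data or on $t$) such that for all $u_1,u_0\in H_1$ with $Du_1+Au_0\in H$ (that is, $(u_1,u_0)^\top\in\mathrm{Dom}(\mathcal T)$, where $\mathcal T=\begin{pmatrix}-D&-A\\ I&0\end{pmatrix}$ in $H\times H_1$) the Cauchy problem $$u''(t)+Du'(t)+Au(t)=0\quad(t\ge0),\qquad u(0)=u_0,\quad u'(0)=u_1,$$ has a unique classical solution $u$ on $[0,\infty)$, i.e. a unique $u\in C^1([0,\infty);H_1)$ with $u'\in C^1([0,\infty);H)$ that satisfies the equation in $H_{-1}$ for every $t\ge0$ and the initial conditions; and for all $t\ge0$ $$\|u(t)\|_1^2+\|u'(t)\|^2\le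 C\,e^{-2\omega t}\left(\|u_0\|_1^2+\|u_1\|^2\right).$$ -/

import Mathlib

open Set
open scoped InnerProductSpace

/-- A self-adjoint positive definite (generally unbounded, densely defined) operator in the complex
Hilbert space `H`. Density of the domain is part of self-adjointness in Mathlib
(`IsSelfAdjoint.dense_domain`); `posDef` says that the lower bound `a₀` of the quadratic form
`(A x, x)` is positive. -/
structure PosDefOperator (H : Type*) [NormedAddCommGroup H] [InnerProductSpace ℂ H]
    [CompleteSpace H] where
  /-- the underlying partially defined linear operator -/
  op : H →ₗ.[ℂ] H
  selfAdjoint : IsSelfAdjoint op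
  posDef : ∃ a₀ : ℝ, 0 < a₀ ∧ ∀ x : op.domain, a₀ * ‖(x : H)‖ ^ 2 ≤ (⟪op x, (x : H)⟫_ℂ).re

namespace PosDefOperator

variable {H : Type*} [NormedAddCommGroup H] [InnerProductSpace ℂ H] [CompleteSpace H]
  (A : PosDefOperator H)

/-! ### The bounded inverse `A⁻¹` -/

theorem exists_lower_bound :
    ∃ c : ℝ, 0 < c ∧ ∀ x : A.op.domain, ‖(x : H)‖ ≤ c * ‖A.op x‖ := by
  obtain ⟨a, ha, h⟩ := A.posDef
  refine ⟨a⁻¹, inv_pos.2 ha, fun x => ?_⟩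
  have h1 : a * ‖(x : H)‖ ^ 2 ≤ ‖A.op x‖ * ‖(x : H)‖ :=
    (h x).trans ((Complex.re_le_norm _).trans (norm_inner_le_norm _ _))
  rw [← div_eq_inv_mul, le_div_iff₀ ha]
  by_cases hx : ‖(x : H)‖ = 0
  · rw [hx]; simp
  · have hpos : 0 < ‖(x : H)‖ := lt_of_le_of_ne (norm_nonneg _) (Ne.symm hx)
    nlinarith

theorem op_injective : Function.Injective A.op.toFun := by
  obtain ⟨c, -, h⟩ := A.exists_lower_bound
  refine (injective_iff_map_eq_zero A.op.toFun).2 fun x hx => ?_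
  have h1 := h x
  have h2 : A.op x = 0 := hx
  rw [h2, norm_zero, mul_zero] at h1
  exact Subtype.ext (norm_le_zero_iff.1 h1)

theorem op_surjective : Function.Surjective A.op.toFun := by
  obtain ⟨c, hc, h⟩ := A.exists_lower_bound
  have hd := A.selfAdjoint.dense_domain
  have hcl : IsClosed (A.op.graph : Set (H × H)) := A.selfAdjoint.isClosed
  have : CompleteSpace A.op.graph := hcl.completeSpace_coe
  let f : A.op.graph →L[ℂ] H := (ContinuousLinearMap.snd ℂ H H).comp A.op.graph.subtypeL
  have hf : AntilipschitzWith (max c 1).toNNReal f := by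
    refine ContinuousLinearMap.antilipschitz_of_bound f fun p => ?_
    obtain ⟨⟨x, y⟩, hp⟩ := p
    obtain ⟨z, hz1, hz2⟩ := (LinearPMap.mem_graph_iff _).1 hp
    simp only at hz1 hz2
    have hz := h z
    rw [hz1, hz2] at hz
    rw [Real.coe_toNNReal _ (le_trans zero_le_one (le_max_right c 1))]
    change max ‖x‖ ‖y‖ ≤ max c 1 * ‖y‖
    refine max_le (hz.trans ?_) ?_
    · exact mul_le_mul_of_nonneg_right (le_max_left _ _) (norm_nonneg _)
    · exact le_mul_of_one_le_left (norm_nonneg _) (le_max_right _ _)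
  have hrange : IsClosed (Set.range f) := hf.isClosed_range f.uniformContinuous
  have heq : Set.range f = (LinearMap.range A.op.toFun : Set H) := by
    ext y
    constructor
    · rintro ⟨⟨⟨x, y'⟩, hp⟩, rfl⟩
      obtain ⟨z, -, hz2⟩ := (LinearPMap.mem_graph_iff _).1 hp
      exact ⟨z, hz2⟩
    · rintro ⟨z, rfl⟩
      exact ⟨⟨((z : H), A.op z), A.op.mem_graph z⟩, rfl⟩
  rw [heq] at hrange
  have : CompleteSpace (LinearMap.range A.op.toFun) := hrange.completeSpace_coe
  have hbot : (LinearMap.range A.op.toFun)ᗮ = ⊥ := by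
    refine (Submodule.eq_bot_iff _).2 fun y hy => ?_
    have hy' : ∀ x : A.op.domain, ⟪(0 : H), (x : H)⟫_ℂ = ⟪y, A.op x⟫_ℂ := fun x => by
      rw [inner_zero_left]
      exact ((Submodule.mem_orthogonal' _ _).1 hy _ ⟨x, rfl⟩).symm
    have hmem : y ∈ A.op.adjoint.domain :=
      LinearPMap.mem_adjoint_domain_of_exists y ⟨0, hy'⟩
    have hzero : A.op.adjoint ⟨y, hmem⟩ = 0 := LinearPMap.adjoint_apply_eq hd ⟨y, hmem⟩ hy'
    have hg : (y, (0 : H)) ∈ A.op.adjoint.graph :=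
      (LinearPMap.mem_graph_iff _).2 ⟨⟨y, hmem⟩, rfl, hzero⟩
    rw [LinearPMap.isSelfAdjoint_def.1 A.selfAdjoint] at hg
    obtain ⟨z, hz1, hz2⟩ := (LinearPMap.mem_graph_iff _).1 hg
    have hz := h z
    simp only at hz1 hz2
    rw [hz1, hz2, norm_zero, mul_zero] at hz
    exact norm_le_zero_iff.1 hz
  exact LinearMap.range_eq_top.1 ((Submodule.orthogonal_eq_bot_iff).1 hbot)

/-- `A : Dom(A) → H` as a linear bijection. -/
noncomputable def equiv : A.op.domain ≃ₗ[ℂ] H :=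
  LinearEquiv.ofBijective A.op.toFun ⟨A.op_injective, A.op_surjective⟩

/-- The bounded operator `A⁻¹` in `H`. -/
noncomputable def inv : H →L[ℂ] H :=
  LinearMap.mkContinuousOfExistsBound (A.op.domain.subtype.comp A.equiv.symm.toLinearMap) <| by
    obtain ⟨c, -, h⟩ := A.exists_lower_bound
    refine ⟨c, fun y => (h (A.equiv.symm y)).trans (le_of_eq ?_)⟩
    have : A.op (A.equiv.symm y) = y := A.equiv.apply_symm_apply y
    rw [this]

theorem inv_injective : Function.Injective A.inv :=
  Subtype.val_injective.comp A.equiv.symm.injective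

theorem inv_nonneg : 0 ≤ A.inv := by
  obtain ⟨a, ha, h⟩ := A.posDef
  have hd := A.selfAdjoint.dense_domain
  have hform := LinearPMap.adjoint_isFormalAdjoint hd
  rw [LinearPMap.isSelfAdjoint_def.1 A.selfAdjoint] at hform
  rw [ContinuousLinearMap.nonneg_iff_isPositive, ContinuousLinearMap.isPositive_iff_complex]
  intro y
  obtain ⟨x, rfl⟩ := A.equiv.surjective y
  have e1 : A.inv (A.equiv x) = (x : H) :=
    congrArg Subtype.val (A.equiv.symm_apply_apply x)
  have e2 : A.equiv x = A.op x := rfl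
  rw [e1, e2]
  have hsym : ⟪A.op x, (x : H)⟫_ℂ = ⟪(x : H), A.op x⟫_ℂ := hform x x
  have hreal : (starRingEnd ℂ) ⟪(x : H), A.op x⟫_ℂ = ⟪(x : H), A.op x⟫_ℂ := by
    rw [inner_conj_symm]; exact hsym
  refine ⟨Complex.conj_eq_iff_re.1 hreal, ?_⟩
  have := h x
  rw [hsym] at this
  exact le_trans (by positivity) this

/-! ### The square roots `A^{-1/2}` and `A^{1/2}` -/

/-- The bounded operator `A^{-1/2}`: the positive square root of `A⁻¹`. -/
noncomputable def sqrtInv : H →L[ℂ] H := CFC.sqrt A.inv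

theorem sqrtInv_sqrtInv (x : H) : A.sqrtInv (A.sqrtInv x) = A.inv x :=
  congrArg (fun T : H →L[ℂ] H => T x) (CFC.sqrt_mul_sqrt_self A.inv A.inv_nonneg)

theorem sqrtInv_injective : Function.Injective A.sqrtInv := fun x y hxy =>
  A.inv_injective (by rw [← A.sqrtInv_sqrtInv, ← A.sqrtInv_sqrtInv, hxy])

/-- The operator `A^{1/2} : Dom(A^{1/2}) → H`, the inverse of `A^{-1/2}`; its domain is the range of
`A^{-1/2}`. -/
noncomputable def sqrtEquiv : LinearMap.range A.sqrtInv.toLinearMap ≃ₗ[ℂ] H :=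
  (LinearEquiv.ofInjective A.sqrtInv.toLinearMap A.sqrtInv_injective).symm

/-- The space `H₁ = Dom(A^{1/2})`; as a type of its own, since its norm is not that of `H`. -/
def H1 : Type _ := LinearMap.range A.sqrtInv.toLinearMap

/-- `‖x‖₁ = ‖A^{1/2} x‖`. -/
noncomputable instance : NormedAddCommGroup A.H1 :=
  NormedAddCommGroup.induced (LinearMap.range A.sqrtInv.toLinearMap) H
    A.sqrtEquiv.toLinearMap A.sqrtEquiv.injective

/-- `(x, y)₁ = (A^{1/2} x, A^{1/2} y)`. -/
noncomputable instance : InnerProductSpace ℂ A.H1 where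
  __ := (inferInstance : Module ℂ (LinearMap.range A.sqrtInv.toLinearMap))
  norm_smul_le c x := by
    change ‖A.sqrtEquiv (c • (show LinearMap.range A.sqrtInv.toLinearMap from x))‖ ≤
      ‖c‖ * ‖A.sqrtEquiv x‖
    rw [map_smul]; exact norm_smul_le c _
  inner x y := ⟪A.sqrtEquiv x, A.sqrtEquiv y⟫_ℂ
  norm_sq_eq_re_inner x := norm_sq_eq_re_inner (𝕜 := ℂ) (A.sqrtEquiv x)
  conj_inner_symm x y := inner_conj_symm _ _
  add_left x y z :=
    (congrArg (fun v => ⟪v, A.sqrtEquiv z⟫_ℂ) (A.sqrtEquiv.map_add x y)).trans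
      (inner_add_left _ _ _)
  smul_left x y r :=
    (congrArg (fun v => ⟪v, A.sqrtEquiv y⟫_ℂ) (A.sqrtEquiv.map_smul r x)).trans
      (inner_smul_left _ _ _)

/-- `A^{1/2}` as a linear bijection from `H₁` onto `H`. -/
noncomputable def sqrt : A.H1 ≃ₗ[ℂ] H where
  toFun := A.sqrtEquiv
  invFun := A.sqrtEquiv.symm
  map_add' := A.sqrtEquiv.map_add
  map_smul' := A.sqrtEquiv.map_smul
  left_inv := A.sqrtEquiv.left_inv
  right_inv := A.sqrtEquiv.right_inv

theorem norm_H1 (x : A.H1) : ‖x‖ = ‖A.sqrt x‖ := rfl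

theorem inner_H1 (x y : A.H1) : ⟪x, y⟫_ℂ = ⟪A.sqrt x, A.sqrt y⟫_ℂ := rfl

/-- The embedding of `H₁` into `H`. -/
noncomputable def incl : A.H1 →L[ℂ] H :=
  LinearMap.mkContinuous
    { toFun := fun x => (LinearMap.range A.sqrtInv.toLinearMap).subtype x
      map_add' := fun _ _ => rfl
      map_smul' := fun _ _ => rfl } ‖A.sqrtInv‖ fun x =>
    (congrArg (fun z : LinearMap.range A.sqrtInv.toLinearMap => ‖(z : H)‖)
      (A.sqrtEquiv.symm_apply_apply x).symm).trans_le (A.sqrtInv.le_opNorm (A.sqrt x))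

theorem incl_eq (x : A.H1) : A.incl x = A.sqrtInv (A.sqrt x) :=
  congrArg Subtype.val (A.sqrtEquiv.symm_apply_apply x).symm

/-! ### The space `H₋₁` -/

/-- The space `H₋₁`, regarded as the (conjugate) dual of `H₁`: the space of bounded
conjugate-linear functionals on `H₁`. For `f : A.Hm1` and `x : A.H1`, the value `f x` is the duality
pairing `(f, x)_{-1,1}`, and `‖f‖` is the dual norm. -/
abbrev Hm1 : Type _ := A.H1 →L⋆[ℂ] ℂ

/-- The embedding of the pivot space `H` into `H₋₁`: `(h, x)_{-1,1} = (h, x)`.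
(Mathlib's inner product is linear in the second argument, so `(h, x)` is `⟪x, h⟫_ℂ`.) -/
noncomputable def emb (h : H) : A.Hm1 := ((innerSL ℂ).flip h).comp A.incl

theorem emb_apply (h : H) (x : A.H1) : A.emb h x = ⟪A.incl x, h⟫_ℂ := rfl

/-- The norm of `H₋₁` is given on `H` by `‖h‖₋₁ = ‖A^{-1/2} h‖`. -/
theorem norm_emb (h : H) : ‖A.emb h‖ = ‖A.sqrtInv h‖ := by
  have hsa : ∀ x y : H, ⟪A.sqrtInv x, y⟫_ℂ = ⟪x, A.sqrtInv y⟫_ℂ := fun x y =>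
    ((ContinuousLinearMap.nonneg_iff_isPositive _).1
      (CFC.sqrt_nonneg A.inv)).isSymmetric x y
  have key : ∀ x : A.H1, A.emb h x = ⟪A.sqrt x, A.sqrtInv h⟫_ℂ := fun x => by
    rw [emb_apply, incl_eq, hsa]
  refine le_antisymm ?_ ?_
  · refine ContinuousLinearMap.opNorm_le_bound _ (norm_nonneg _) fun x => ?_
    rw [key, norm_H1, mul_comm]
    exact norm_inner_le_norm _ _
  · obtain ⟨x, hx⟩ := A.sqrt.surjective (A.sqrtInv h)
    have h1 := (A.emb h).le_opNorm x
    rw [key, norm_H1, hx, inner_self_eq_norm_sq_to_K, norm_pow, RCLike.norm_ofReal,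
      abs_of_nonneg (norm_nonneg (A.sqrtInv h))] at h1
    by_cases h0 : ‖A.sqrtInv h‖ = 0
    · rw [h0]; exact norm_nonneg _
    · have : 0 < ‖A.sqrtInv h‖ := lt_of_le_of_ne (norm_nonneg _) (Ne.symm h0)
      nlinarith

/-- `A` as a bounded operator from `H₁` to `H₋₁`: `(A x, y)_{-1,1} = (A^{1/2} x, A^{1/2} y)`. -/
noncomputable def ext : A.H1 →L[ℂ] A.Hm1 := (innerSL ℂ).flip

theorem ext_apply (x y : A.H1) : A.ext x y = ⟪A.sqrt y, A.sqrt x⟫_ℂ := rfl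


/-- On `Dom(A)` the operator `A.ext` is the original operator `A`. -/
theorem ext_eq_op (x : A.op.domain) : ∃ z : A.H1, A.incl z = x ∧ A.ext z = A.emb (A.op x) := by
  refine ⟨A.sqrt.symm (A.sqrtInv (A.op x)), ?_, ?_⟩
  · rw [incl_eq, LinearEquiv.apply_symm_apply, sqrtInv_sqrtInv]
    exact congrArg Subtype.val (A.equiv.symm_apply_apply x)
  · ext y
    rw [emb_apply, incl_eq, ext_apply, LinearEquiv.apply_symm_apply]
    exact (((ContinuousLinearMap.nonneg_iff_isPositive _).1
      (CFC.sqrt_nonneg A.inv)).isSymmetric _ _).symm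

/-! ### The damping operator -/

variable {A} (D : A.H1 →L[ℂ] A.Hm1)

/-- `D` is accretive and sectorial:
`Re (D x, x)_{-1,1} ≥ 0` and `|Im (D x, x)_{-1,1}| ≤ ν Re (D x, x)_{-1,1}` for some `ν > 0`. -/
def IsAccretiveSectorial : Prop :=
  (∀ x : A.H1, 0 ≤ (D x x).re) ∧
    ∃ ν : ℝ, 0 < ν ∧ ∀ x : A.H1, |(D x x).im| ≤ ν * (D x x).re

/-- `α = inf Re (D x, x)_{-1,1} / ‖x‖₋₁²` over nonzero `x ∈ H₁`. -/
noncomputable def alpha : ℝ :=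
  ⨅ x : {x : A.H1 // x ≠ 0}, (D x.1 x.1).re / ‖A.emb (A.incl x.1)‖ ^ 2

/-- `β = inf Re (D x, x)_{-1,1} / ‖x‖²` over nonzero `x ∈ H₁`. -/
noncomputable def beta : ℝ :=
  ⨅ x : {x : A.H1 // x ≠ 0}, (D x.1 x.1).re / ‖A.incl x.1‖ ^ 2

/-- `δ = inf Re (D x, x)_{-1,1} / ‖x‖₁²` over nonzero `x ∈ H₁`. -/
noncomputable def delta : ℝ :=
  ⨅ x : {x : A.H1 // x ≠ 0}, (D x.1 x.1).re / ‖x.1‖ ^ 2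

/-- The exponential decay rate `ω`; here `‖D‖` is the norm of `D` as an operator from `H₁` to
`H₋₁`. -/
noncomputable def decayRate : ℝ :=
  (1 / beta D + 2 / √(alpha D * delta D) + ‖D‖ ^ 2 / (2 * delta D) +
    √(4 * ‖D‖ ^ 2 / (delta D * √(alpha D * delta D)) + ‖D‖ ^ 4 / delta D ^ 2))⁻¹

/-! ### The Cauchy problem -/

/-- The domain of the operator matrix `T = (-D, -A; I, 0)` in the energy space `H × H₁`:
the pairs `(w₁, w₂) ∈ H₁ × H₁` with `D w₁ + A w₂ ∈ H`. -/
def domT : Set (A.H1 × A.H1) := {w | ∃ h : H, D w.1 + A.ext w.2 = A.emb h}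

/-- The derivative `u'` (in `H₁`) on the half-line `[0, ∞)`; it is one-sided at `0`. -/
noncomputable def velocity (u : ℝ → A.H1) (t : ℝ) : A.H1 := derivWithin u (Ici 0) t

/-- The derivative `u''` (in `H`) on the half-line `[0, ∞)`; it is one-sided at `0`. -/
noncomputable def acceleration (u : ℝ → A.H1) (t : ℝ) : H :=
  derivWithin (fun s => A.incl (velocity u s)) (Ici 0) t

/-- `u` is a (classical) solution on `[0, ∞)` of `u'' + D u' + A u = 0` (an equality in `H₋₁`) with
`u(0) = u₀`, `u'(0) = u₁`. The regularity `u ∈ C¹([0, ∞); H₁)`, `u' ∈ C¹([0, ∞); H)` says that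
`(u', u)` is continuously differentiable in the energy space `H × H₁`. Only the values of `u` on
`[0, ∞)` matter. -/
structure IsSolution (u₁ u₀ : A.H1) (u : ℝ → A.H1) : Prop where
  contDiffOn : ContDiffOn ℝ 1 u (Ici 0)
  contDiffOn_velocity : ContDiffOn ℝ 1 (fun t => A.incl (velocity u t)) (Ici 0)
  equation : ∀ t : ℝ, 0 ≤ t → A.emb (acceleration u t) + D (velocity u t) + A.ext (u t) = 0
  initial_position : u 0 = u₀
  initial_velocity : velocity u 0 = u₁

end PosDefOperator

/-! Decay comes from the modified energy F = ‖u‖₁² + ‖u'‖² + 4ω Re(u, u'). The equation, paired with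
u' and with u, shows that F' + 2ωF is twice the expression in `dissipation_nonpos`. With s² =
Re(Du', u'), the definitions of α, β, δ bound that expression by a quadratic form in s and ‖u‖₁. The
form is nonpositive as soon as K(1 + 2c/W)² ≤ W - 3b, where W = 1/ω, b = 1/β, c = 1/√(αδ), K =
‖D‖²/δ; the rate ω satisfies this by `mul_sq_le_sub_of_rate`. Hence e^{2ωt}F is nonincreasing
(`energy_le`). By `abs_correction_le`, F lies between 1/2 and 3/2 of the energy, so C = 3. Applied
to a difference of two solutions, the same estimate gives uniqueness.

For existence, the unbounded matrix T is replaced by its bounded inverse J (`matrixInv`), which is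
injective and dissipative on the Hilbert space H × H₁. `DissipativeInverse.exists_hasDerivAt` is the
Hille–Yosida construction in terms of J alone: the operators (J - ε)⁻¹ are the Yosida approximations
of J⁻¹, their exponentials are contractions, and these converge strongly as ε → 0. The limit z and w
= Jz satisfy w' = z; here w = (u', u) and z = (u'', u'). -/

/-! ### Contraction semigroups generated by the inverse of a bounded dissipative operator -/

namespace DissipativeInverse

open Filter Topology

/-! ### Resolvents of a bounded dissipative operator. -/

variable {X : Type*} [NormedAddCommGroup X] [InnerProductSpace ℂ X] {J : X →L[ℂ] X}

/-- Substitute x = (J - ε)Gx in the second argument. The term ε‖Gx‖² is kept because it yields the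
bound ‖G‖ ≤ 1/ε. -/
theorem re_inner_inverse_nonpos (hJ : ∀ x, (⟪J x, x⟫_ℂ).re ≤ 0) {ε : ℝ}
    {G : X →L[ℂ] X} (hG : ∀ x, J (G x) - (ε : ℂ) • G x = x) (x : X) :
    (⟪G x, x⟫_ℂ).re ≤ - (ε * ‖G x‖ ^ 2) := by
  have e : (⟪G x, G x⟫_ℂ).re = ‖G x‖ ^ 2 := inner_self_eq_norm_sq (𝕜 := ℂ) (G x)
  have h : (⟪G x, x⟫_ℂ).re = (⟪J (G x), G x⟫_ℂ).re - ε * ‖G x‖ ^ 2 := by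
    have h0 : ⟪G x, x⟫_ℂ = ⟪G x, J (G x) - (ε : ℂ) • G x⟫_ℂ := by rw [hG x]
    rw [h0, inner_sub_right, inner_smul_right, Complex.sub_re, Complex.re_ofReal_mul, e,
      ← inner_conj_symm, Complex.conj_re]
  linarith [hJ (G x)]

theorem norm_inverse_apply_le (hJ : ∀ x, (⟪J x, x⟫_ℂ).re ≤ 0) {ε : ℝ}
    {G : X →L[ℂ] X} (hG : ∀ x, J (G x) - (ε : ℂ) • G x = x) (x : X) : ε * ‖G x‖ ≤ ‖x‖ := by
  have h1 := re_inner_inverse_nonpos hJ hG x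
  have h2 := (Complex.abs_re_le_norm _).trans (norm_inner_le_norm (𝕜 := ℂ) (G x) x)
  have h3 := neg_abs_le (⟪G x, x⟫_ℂ).re
  rcases (norm_nonneg (G x)).eq_or_lt with h | h
  · rw [← h]; simp
  · nlinarith

/-- Consistency of the approximation: G tends to J⁻¹ on the range of J², with an explicit rate,
since GJ = 1 + εG used twice gives GJ²x - Jx = εx + ε²Gx. -/
theorem norm_inverse_apply_sub_le (hJ : ∀ x, (⟪J x, x⟫_ℂ).re ≤ 0) {ε : ℝ} (hε : 0 < ε)
    {G : X →L[ℂ] X} (hl : ∀ x, G (J x) - (ε : ℂ) • G x = x)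
    (hG : ∀ x, J (G x) - (ε : ℂ) • G x = x) (x : X) :
    ‖G (J (J x)) - J x‖ ≤ 2 * ε * ‖x‖ := by
  have e : G (J (J x)) - J x = (ε : ℂ) • x + (ε : ℂ) • (ε : ℂ) • G x := by
    rw [sub_eq_iff_eq_add.1 (hl (J x)), sub_eq_iff_eq_add.1 (hl x), add_sub_cancel_left, smul_add]
  have h := norm_inverse_apply_le hJ hG x
  rw [e]
  refine (norm_add_le _ _).trans ?_
  simp only [norm_smul, Complex.norm_real, Real.norm_eq_abs, abs_of_pos hε]
  nlinarith

/-! ### Contractive exponentials and passage to the limit. -/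

variable [CompleteSpace X]

theorem hasDerivAt_exp_apply (G : X →L[ℂ] X) (x : X) (t : ℝ) :
    HasDerivAt (fun s : ℝ => NormedSpace.exp (s • G) x) (G (NormedSpace.exp (t • G) x)) t :=
  ((ContinuousLinearMap.apply ℂ X x).restrictScalars ℝ).hasFDerivAt.comp_hasDerivAt t
    (hasDerivAt_exp_smul_const' (𝕂 := ℝ) G t)

/-- The derivative of ‖exp(sG)x‖² is twice the real part of the form of G at exp(sG)x, hence
nonpositive. -/
theorem norm_exp_apply_le {G : X →L[ℂ] X} (hG : ∀ x, (⟪G x, x⟫_ℂ).re ≤ 0) {t : ℝ} (ht : 0 ≤ t)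
    (x : X) : ‖NormedSpace.exp (t • G) x‖ ≤ ‖x‖ := by
  have hd : ∀ s : ℝ, HasDerivAt
      (fun s : ℝ => (⟪NormedSpace.exp (s • G) x, NormedSpace.exp (s • G) x⟫_ℂ).re)
      (2 * (⟪G (NormedSpace.exp (s • G) x), NormedSpace.exp (s • G) x⟫_ℂ).re) s := fun s => by
    have h := Complex.reCLM.hasFDerivAt.comp_hasDerivAt s
      ((hasDerivAt_exp_apply G x s).inner ℂ (hasDerivAt_exp_apply G x s))
    refine h.congr_deriv ?_
    rw [Complex.reCLM_apply, Complex.add_re, ← inner_conj_symm, Complex.conj_re]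
    ring
  have hanti := antitone_of_deriv_nonpos (fun s => (hd s).differentiableAt) fun s => by
    rw [(hd s).deriv]
    nlinarith [hG (NormedSpace.exp (s • G) x)]
  have h := hanti ht
  simp only [zero_smul, NormedSpace.exp_zero, one_apply_eq_self] at h
  have e : ∀ y : X, (⟪y, y⟫_ℂ).re = ‖y‖ ^ 2 := fun y => inner_self_eq_norm_sq (𝕜 := ℂ) y
  rw [e, e] at h
  exact (sq_le_sq₀ (norm_nonneg _) (norm_nonneg _)).1 h

/-- The path s ↦ exp(sG) exp((t - s)G')x joins the two vectors, and by commutation its velocity is a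
product of two contractions applied to (G - G')x. -/
theorem norm_exp_apply_sub_exp_apply_le {G G' : X →L[ℂ] X} (hG : ∀ x, (⟪G x, x⟫_ℂ).re ≤ 0)
    (hG' : ∀ x, (⟪G' x, x⟫_ℂ).re ≤ 0) (hc : Commute G G') {t : ℝ} (ht : 0 ≤ t) (x : X) :
    ‖NormedSpace.exp (t • G) x - NormedSpace.exp (t • G') x‖ ≤ t * ‖G x - G' x‖ := by
  have hd : ∀ s : ℝ, HasDerivAt
      (fun s : ℝ => (NormedSpace.exp (s • G) * NormedSpace.exp ((t - s) • G')) x)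
      (NormedSpace.exp (s • G) (NormedSpace.exp ((t - s) • G') (G x - G' x))) s := fun s => by
    have h1 := hasDerivAt_exp_smul_const (𝕂 := ℝ) G s
    have h2 : HasDerivAt (fun s : ℝ => NormedSpace.exp ((t - s) • G'))
        (-(NormedSpace.exp ((t - s) • G') * G')) s := by
      have := (hasDerivAt_exp_smul_const (𝕂 := ℝ) G' (t - s)).scomp s
        ((hasDerivAt_id s).const_sub t)
      simpa [Function.comp_def] using this
    have h := ((ContinuousLinearMap.apply ℂ X x).restrictScalars ℝ).hasFDerivAt.comp_hasDerivAt s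
      (h1.mul h2)
    refine h.congr_deriv ?_
    have hcomm : G * NormedSpace.exp ((t - s) • G') = NormedSpace.exp ((t - s) • G') * G :=
      ((hc.smul_right (t - s)).exp_right).eq
    have e : NormedSpace.exp (s • G) * G * NormedSpace.exp ((t - s) • G') +
        NormedSpace.exp (s • G) * -(NormedSpace.exp ((t - s) • G') * G') =
        NormedSpace.exp (s • G) * (NormedSpace.exp ((t - s) • G') * (G - G')) := by
      rw [mul_assoc, hcomm]; noncomm_ring
    rw [e]; rfl
  have h := norm_image_sub_le_of_norm_deriv_le_segment' (a := 0) (b := t)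
    (fun s _ => (hd s).hasDerivWithinAt) (C := ‖G x - G' x‖)
    (fun s hs => (norm_exp_apply_le hG hs.1 _).trans
      (norm_exp_apply_le hG' (sub_nonneg.2 hs.2.le) _)) t (right_mem_Icc.2 ht)
  simpa [mul_comm] using h

/-- A bounded dissipative operator shifted to the left is invertible. -/
theorem exists_inverse_sub_smul (hJ : ∀ x, (⟪J x, x⟫_ℂ).re ≤ 0) {ε : ℝ} (hε : 0 < ε) :
    ∃ G : X →L[ℂ] X, (∀ x, G (J x) - (ε : ℂ) • G x = x) ∧ ∀ x, J (G x) - (ε : ℂ) • G x = x := by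
  have hu : IsUnit (J - (ε : ℂ) • (1 : X →L[ℂ] X)) := by
    -- Lax–Milgram: the form of J - ε is bounded below in modulus by ε‖x‖².
    refine ContinuousLinearMap.isUnit_of_forall_le_norm_inner_map _ (c := ⟨ε, hε.le⟩) hε fun x => ?_
    have h1 : (⟪(J - (ε : ℂ) • (1 : X →L[ℂ] X)) x, x⟫_ℂ).re = (⟪J x, x⟫_ℂ).re - ε * ‖x‖ ^ 2 := by
      have e : (⟪x, x⟫_ℂ).re = ‖x‖ ^ 2 := inner_self_eq_norm_sq (𝕜 := ℂ) x
      simp [← e]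
    have h2 := (neg_abs_le _).trans' (neg_le_neg (Complex.abs_re_le_norm
      ⟪(J - (ε : ℂ) • (1 : X →L[ℂ] X)) x, x⟫_ℂ))
    rw [h1] at h2
    change ‖x‖ ^ 2 * ε ≤ _
    nlinarith [hJ x]
  obtain ⟨u, hu⟩ := hu
  refine ⟨(↑u⁻¹ : X →L[ℂ] X), fun x => ?_, fun x => ?_⟩
  · have := congrArg (fun T : X →L[ℂ] X => T x) u.inv_mul
    rw [hu] at this
    simpa using this
  · have := congrArg (fun T : X →L[ℂ] X => T x) u.mul_inv
    rw [hu] at this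
    simpa using this

/-- If y is orthogonal to the range, dissipativity at y + tJy leaves only t‖Jy‖² + O(t²) ≤ 0, which
for small t > 0 forces Jy = 0. -/
theorem denseRange_of_injective (hJ : ∀ x, (⟪J x, x⟫_ℂ).re ≤ 0) (hinj : Function.Injective J) :
    DenseRange J := by
  have hbot : (LinearMap.range J.toLinearMap)ᗮ = ⊥ := by
    refine (Submodule.eq_bot_iff _).2 fun y hy => ?_
    have hy' : ∀ x, ⟪J x, y⟫_ℂ = 0 := fun x => (Submodule.mem_orthogonal _ _).1 hy _ ⟨x, rfl⟩
    have key : ∀ t : ℝ, t * ‖J y‖ ^ 2 + t ^ 2 * (⟪J (J y), J y⟫_ℂ).re ≤ 0 := fun t => by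
      have h := hJ (y + (t : ℂ) • J y)
      have e : (⟪J y, J y⟫_ℂ).re = ‖J y‖ ^ 2 := inner_self_eq_norm_sq (𝕜 := ℂ) (J y)
      simp only [map_add, map_smul, inner_add_left, inner_add_right, inner_smul_left,
        inner_smul_right, hy', Complex.conj_ofReal, Complex.add_re, Complex.re_ofReal_mul, e] at h
      simp only [Complex.zero_re, mul_zero] at h
      nlinarith
    have hzero : J y = 0 := by
      by_contra hne
      have hpos : 0 < ‖J y‖ ^ 2 := by positivity
      set q := (⟪J (J y), J y⟫_ℂ).re
      -- For this t one has ‖Jy‖² = t(1 + |q|), so the left side becomes t²(1 + |q| + q) > 0.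
      have h := key (‖J y‖ ^ 2 / (1 + |q|))
      have hq : 0 < 1 + |q| := by positivity
      have h2 : ‖J y‖ ^ 2 / (1 + |q|) * ‖J y‖ ^ 2 + (‖J y‖ ^ 2 / (1 + |q|)) ^ 2 * q =
        (‖J y‖ ^ 2 / (1 + |q|)) ^ 2 * (1 + |q| + q) := by field_simp
      rw [h2] at h
      have : 0 < 1 + |q| + q := by linarith [neg_abs_le q]
      have : 0 < (‖J y‖ ^ 2 / (1 + |q|)) ^ 2 * (1 + |q| + q) := by positivity
      linarith
    exact hinj (hzero.trans (map_zero J).symm)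
  have := (Submodule.topologicalClosure_eq_top_iff).2 hbot
  exact (Submodule.dense_iff_topologicalClosure_eq_top).2 this

/-- For a bounded injective dissipative `J`, the problem `J z' = z`, `z 0 = z₀` has a (mild)
solution on `[0, ∞)`; that is, `w = J z` solves `w' = J⁻¹ w`. -/
theorem exists_hasDerivAt (hJ : ∀ x, (⟪J x, x⟫_ℂ).re ≤ 0) (hinj : Function.Injective J) (z₀ : X) :
    ∃ z w : ℝ → X, Continuous z ∧ z 0 = z₀ ∧ (∀ t, HasDerivAt w (z t) t) ∧
      ∀ t, 0 ≤ t → w t = J (z t) := by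
  have hε : ∀ n : ℕ, (0 : ℝ) < 1 / (n + 1) := fun n => by positivity
  choose G hl hr using fun n : ℕ => exists_inverse_sub_smul hJ (hε n)
  have hG : ∀ n x, (⟪G n x, x⟫_ℂ).re ≤ 0 := fun n x =>
    (re_inner_inverse_nonpos hJ (hr n) x).trans
      (neg_nonpos.2 (mul_nonneg (hε n).le (sq_nonneg _)))
  have hGJ : ∀ n, Commute (G n) J := fun n => by
    refine ContinuousLinearMap.ext fun x => ?_
    have := (hl n x).trans (hr n x).symm
    simpa using this
  have hcomm : ∀ m n, Commute (G m) (G n) := fun m n => by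
    refine ContinuousLinearMap.ext fun x => ?_
    have h1 : ∀ y, G m (J y) = J (G m y) := fun y => congrArg (fun T : X →L[ℂ] X => T y) (hGJ m).eq
    change G m (G n x) = G n (G m x)
    rw [← hl n (G m (G n x)), ← h1, ← map_smul (G n), ← map_sub, ← map_smul, ← map_sub, hr]
  set Z : ℕ → ℝ → X := fun n t => NormedSpace.exp (t • G n) z₀ with hZ
  -- On the range of J² the approximations converge with a rate; contractivity carries the Cauchy
  -- property over to every initial vector.
  have hdense : DenseRange (fun x => J (J x)) :=
    (denseRange_of_injective hJ hinj).comp (denseRange_of_injective hJ hinj) J.continuous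
  have hlim : Tendsto (fun n : ℕ => (1 : ℝ) / (n + 1)) atTop (𝓝 0) :=
    tendsto_one_div_add_atTop_nhds_zero_nat
  have hcauchy : ∀ R : ℝ, UniformCauchySeqOn Z atTop (Icc 0 R) := fun R => by
    rw [Metric.uniformCauchySeqOn_iff]
    intro e he
    obtain ⟨x, hx⟩ := hdense.exists_dist_lt z₀ (by positivity : 0 < e / 4)
    rw [dist_eq_norm] at hx
    have hsmall : ∀ᶠ n : ℕ in atTop, |R| * (2 * ((1 : ℝ) / (n + 1)) * ‖x‖) < e / 4 := by
      have : Tendsto (fun n : ℕ => |R| * (2 * ((1 : ℝ) / (n + 1)) * ‖x‖)) atTop (𝓝 0) := by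
        simpa using (((hlim.const_mul 2).mul_const ‖x‖).const_mul |R|)
      exact this.eventually_lt_const (by positivity)
    obtain ⟨N, hN⟩ := eventually_atTop.1 hsmall
    refine ⟨N, fun m hm n hn t ht => ?_⟩
    have h1 : ∀ k, ‖Z k t - NormedSpace.exp (t • G k) (J (J x))‖ < e / 4 := fun k => by
      rw [hZ]
      simp only
      rw [← map_sub]
      exact (norm_exp_apply_le (hG k) ht.1 _).trans_lt hx
    have h2 := norm_exp_apply_sub_exp_apply_le (hG m) (hG n) (hcomm m n) ht.1 (J (J x))
    have h3 : ‖G m (J (J x)) - G n (J (J x))‖ ≤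
        2 * ((1 : ℝ) / (m + 1)) * ‖x‖ + 2 * ((1 : ℝ) / (n + 1)) * ‖x‖ := by
      have a := norm_inverse_apply_sub_le hJ (hε m) (hl m) (hr m) x
      have b := norm_inverse_apply_sub_le hJ (hε n) (hl n) (hr n) x
      calc _ = ‖(G m (J (J x)) - J x) - (G n (J (J x)) - J x)‖ := by rw [sub_sub_sub_cancel_right]
        _ ≤ _ := (norm_sub_le _ _).trans (add_le_add a b)
    have h4 : t * ‖G m (J (J x)) - G n (J (J x))‖ ≤ |R| * (2 * ((1 : ℝ) / (m + 1)) * ‖x‖) +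
        |R| * (2 * ((1 : ℝ) / (n + 1)) * ‖x‖) := by
      rw [← mul_add]
      exact mul_le_mul (ht.2.trans (le_abs_self R)) h3 (norm_nonneg _) (abs_nonneg R)
    have h5 := hN m hm
    have h6 := hN n hn
    have h7 := h1 m
    have h8 := h1 n
    rw [dist_eq_norm]
    calc ‖Z m t - Z n t‖ = ‖(Z m t - NormedSpace.exp (t • G m) (J (J x))) -
          (Z n t - NormedSpace.exp (t • G n) (J (J x))) +
          (NormedSpace.exp (t • G m) (J (J x)) - NormedSpace.exp (t • G n) (J (J x)))‖ := by
            congr 1; abel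
      _ ≤ ‖Z m t - NormedSpace.exp (t • G m) (J (J x))‖ +
          ‖Z n t - NormedSpace.exp (t • G n) (J (J x))‖ +
          ‖NormedSpace.exp (t • G m) (J (J x)) - NormedSpace.exp (t • G n) (J (J x))‖ :=
            (norm_add_le _ _).trans (add_le_add_left (norm_sub_le _ _) _)
      _ < e := by linarith
  have hex : ∀ t : ℝ, ∃ y, 0 ≤ t → Tendsto (fun n => Z n t) atTop (𝓝 y) := fun t => by
    by_cases ht : 0 ≤ t
    · obtain ⟨y, hy⟩ := cauchySeq_tendsto_of_complete
        ((hcauchy t).cauchySeq (right_mem_Icc.2 ht))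
      exact ⟨y, fun _ => hy⟩
    · exact ⟨0, fun h => absurd h ht⟩
  choose y hy using hex
  have hZcont : ∀ n, Continuous (Z n) := fun n =>
    continuous_iff_continuousAt.2 fun t => (hasDerivAt_exp_apply (G n) z₀ t).continuousAt
  have hycont : Continuous fun t : ℝ => y (max t 0) := by
    rw [continuous_iff_continuousAt]
    intro t
    have h1 : TendstoUniformlyOn Z y atTop (Icc 0 (|t| + 1)) :=
      (hcauchy (|t| + 1)).tendstoUniformlyOn_of_tendsto fun s hs => hy s hs.1
    have h2 : ContinuousOn y (Icc 0 (|t| + 1)) :=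
      h1.continuousOn (Eventually.of_forall fun n => (hZcont n).continuousOn).frequently
    have h3 : ContinuousOn (fun t : ℝ => y (max t 0)) (Iic (|t| + 1)) :=
      h2.comp (by fun_prop) fun s hs =>
        ⟨le_max_right _ _, max_le hs (by positivity)⟩
    exact h3.continuousAt (Iic_mem_nhds (by linarith [le_abs_self t]))
  -- Freezing z for t < 0 makes it continuous on the whole line, and defining w as a primitive makes
  -- w' = z automatic. What remains is w = Jz for t ≥ 0.
  refine ⟨fun t => y (max t 0), fun t => J z₀ + ∫ s in (0 : ℝ)..t, y (max s 0), hycont, ?_,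
    fun t => ?_, fun t ht => ?_⟩
  · have h := hy 0 le_rfl
    simp only [hZ, zero_smul, NormedSpace.exp_zero, one_apply_eq_self] at h
    simpa using tendsto_nhds_unique h tendsto_const_nhds
  · exact (intervalIntegral.integral_hasDerivAt_right (hycont.intervalIntegrable _ _)
      (hycont.stronglyMeasurableAtFilter _ _) hycont.continuousAt).const_add _
  · have hint : ∀ n, ∫ s in (0 : ℝ)..t, Z n s =
        (J (Z n t) - ((1 / (n + 1) : ℝ) : ℂ) • Z n t) - (J z₀ - ((1 / (n + 1) : ℝ) : ℂ) • z₀) := by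
      intro n
      have h := intervalIntegral.integral_eq_sub_of_hasDerivAt (a := 0) (b := t)
        (f := fun s => (J - ((1 / (n + 1) : ℝ) : ℂ) • (1 : X →L[ℂ] X)) (Z n s)) (f' := Z n)
        (fun s _ => by
          have h := ((J - ((1 / (n + 1) : ℝ) : ℂ) •
            (1 : X →L[ℂ] X)).restrictScalars ℝ).hasFDerivAt.comp_hasDerivAt s
              (hasDerivAt_exp_apply (G n) z₀ s)
          refine h.congr_deriv ?_
          have := hr n (Z n s)
          simpa using this)
        ((hZcont n).intervalIntegrable _ _)
      rw [h]
      simp [hZ]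
    have hyt := hy t ht
    have hlimC : Tendsto (fun n : ℕ => ((1 / (n + 1) : ℝ) : ℂ)) atTop (𝓝 0) := by
      exact (Complex.continuous_ofReal.tendsto' 0 0 Complex.ofReal_zero).comp hlim
    have hr1 : Tendsto (fun n : ℕ => (J (Z n t) - ((1 / (n + 1) : ℝ) : ℂ) • Z n t) -
        (J z₀ - ((1 / (n + 1) : ℝ) : ℂ) • z₀)) atTop (𝓝 (J (y t) - J z₀)) := by
      have a := (((J.continuous.tendsto _).comp hyt).sub (hlimC.smul hyt)).sub
        ((tendsto_const_nhds (x := J z₀)).sub (hlimC.smul_const z₀))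
      simpa using a
    have hr2 : Tendsto (fun n : ℕ => ∫ s in (0 : ℝ)..t, Z n s) atTop
        (𝓝 (∫ s in (0 : ℝ)..t, y (max s 0))) := by
      refine intervalIntegral.tendsto_integral_filter_of_dominated_convergence (fun _ => ‖z₀‖)
        (Eventually.of_forall fun n => (hZcont n).aestronglyMeasurable)
        (Eventually.of_forall fun n => Eventually.of_forall fun s hs => ?_)
        intervalIntegrable_const (Eventually.of_forall fun s hs => ?_)
      all_goals rw [uIoc_of_le ht] at hs
      · exact norm_exp_apply_le (hG n) hs.1.le z₀
      · rw [max_eq_left hs.1.le]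
        exact hy s hs.1.le
    have := tendsto_nhds_unique (hr2.congr hint) hr1
    simp only [this, max_eq_left ht]
    abel

end DissipativeInverse

/-! ### Exponential decay of the energy -/

namespace PosDefOperator

/-- The elementary inequality behind the decay rate. -/
theorem mul_sq_le_sub_of_rate {b c K W : ℝ} (hb : 0 ≤ b) (hbc : b ≤ c) (hK : 0 < K)
    (hW : W = b + 2 * c + K / 2 + √(4 * K * c + K ^ 2)) :
    K * (1 + 2 * c / W) ^ 2 ≤ W - 3 * b := by
  have hc : 0 ≤ c := hb.trans hbc
  set q := √(4 * K * c + K ^ 2) with hq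
  have hq2 : q ^ 2 = 4 * K * c + K ^ 2 := Real.sq_sqrt (by positivity)
  have hKq : K ≤ q := Real.le_sqrt_of_sq_le (by nlinarith [mul_nonneg hK.le hc])
  have hq0 : 0 < q := hK.trans_le hKq
  have hW0 : 0 < W := by rw [hW]; positivity
  set y := 2 * c / W with hy
  have hyW : y * W = 2 * c := div_mul_cancel₀ _ hW0.ne'
  have hy0 : 0 ≤ y := by positivity
  have hy1 : y ≤ 1 := (div_le_one hW0).2 (by linarith)
  -- Drops b from W in yW = 2c. Since q² - K² = 4Kc, this becomes a bound on y in terms of q and K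
  -- alone.
  have h1 : y * (2 * c + K / 2 + q) ≤ 2 * c :=
    (mul_le_mul_of_nonneg_left (by linarith) hy0).trans hyW.le
  have h2 : y * (q ^ 2 + 2 * K * q) ≤ q ^ 2 - K ^ 2 := by
    have e : y * (q ^ 2 + 2 * K * q) = 2 * K * (y * (2 * c + K / 2 + q)) := by rw [hq2]; ring
    rw [e]
    nlinarith [mul_le_mul_of_nonneg_left h1 (by positivity : 0 ≤ 2 * K)]
  -- A cubic inequality in q/K; 1.3 approximates the positive critical point of the difference,
  -- which makes the remainder visibly positive.
  have h3 : 3 * K * (q ^ 2 - K ^ 2) ≤ (q - K / 2) * (q ^ 2 + 2 * K * q) := by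
    have : (q - K / 2) * (q ^ 2 + 2 * K * q) - 3 * K * (q ^ 2 - K ^ 2) =
      (q - 1.3 * K) ^ 2 * (q + 1.1 * K) + 0.17 * K ^ 2 * q + 1.141 * K ^ 3 := by ring
    have : 0 ≤ (q - 1.3 * K) ^ 2 * (q + 1.1 * K) + 0.17 * K ^ 2 * q + 1.141 * K ^ 3 := by positivity
    linarith
  have h4 : 3 * K * y ≤ q - K / 2 := by
    have hpos : 0 < q ^ 2 + 2 * K * q := by positivity
    refine le_of_mul_le_mul_right (le_trans ?_ h3) hpos
    nlinarith [mul_le_mul_of_nonneg_left h2 (by positivity : 0 ≤ 3 * K)]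
  -- With y² ≤ y the goal reduces to K + 3Ky ≤ K/2 + q, and b ≤ c gives K/2 + q ≤ W - 3b.
  have h5 : K * y ^ 2 ≤ K * y := mul_le_mul_of_nonneg_left (by nlinarith) hK.le
  nlinarith

/-! ### Comparison of `alpha`, `beta`, `delta` and ‖D‖. -/

variable {H : Type*} [NormedAddCommGroup H] [InnerProductSpace ℂ H] [CompleteSpace H]
  {A : PosDefOperator H} {D : A.H1 →L[ℂ] A.Hm1}

theorem incl_injective : Function.Injective A.incl := fun x y h => by
  rw [incl_eq, incl_eq] at h
  exact A.sqrt.injective (A.sqrtInv_injective h)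

theorem emb_injective : ∀ h : H, A.emb h = 0 → h = 0 := fun h hh => by
  have := A.norm_emb h
  rw [hh, norm_zero] at this
  exact A.sqrtInv_injective ((norm_eq_zero.1 this.symm).trans (map_zero _).symm)

theorem norm_inner_incl_le (h : H) (x : A.H1) : ‖⟪A.incl x, h⟫_ℂ‖ ≤ ‖A.emb h‖ * ‖x‖ :=
  (A.emb h).le_opNorm x

theorem norm_incl_sq_le (x : A.H1) : ‖A.incl x‖ ^ 2 ≤ ‖A.emb (A.incl x)‖ * ‖x‖ := by
  refine le_trans (le_of_eq ?_) (norm_inner_incl_le (A.incl x) x)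
  rw [inner_self_eq_norm_sq_to_K, norm_pow, RCLike.norm_ofReal, abs_of_nonneg (norm_nonneg _)]

/-- A general N treats the three norms ‖·‖₋₁, ‖·‖ and ‖·‖₁ at once. -/
theorem iInf_div_mul_le (hD : ∀ x : A.H1, 0 ≤ (D x x).re) {N : A.H1 → ℝ} (hN : N 0 = 0)
    (x : A.H1) :
    (⨅ x : {x : A.H1 // x ≠ 0}, (D x.1 x.1).re / N x.1 ^ 2) * N x ^ 2 ≤ (D x x).re := by
  rcases eq_or_ne x 0 with rfl | hx
  · rw [hN]; simp
  rcases eq_or_ne (N x) 0 with h | h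
  · rw [h]; simpa using hD x
  rw [← le_div_iff₀ (by positivity)]
  refine ciInf_le (f := fun x : {x : A.H1 // x ≠ 0} => (D x.1 x.1).re / N x.1 ^ 2)
    ⟨0, ?_⟩ ⟨x, hx⟩
  rintro _ ⟨y, rfl⟩
  exact div_nonneg (hD y.1) (sq_nonneg _)

theorem delta_mul_le (hD : ∀ x : A.H1, 0 ≤ (D x x).re) (x : A.H1) :
    delta D * ‖x‖ ^ 2 ≤ (D x x).re :=
  iInf_div_mul_le hD (N := fun x => ‖x‖) norm_zero x

theorem beta_mul_le (hD : ∀ x : A.H1, 0 ≤ (D x x).re) (x : A.H1) :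
    beta D * ‖A.incl x‖ ^ 2 ≤ (D x x).re :=
  iInf_div_mul_le hD (N := fun x => ‖A.incl x‖) (by simp) x

theorem alpha_mul_le (hD : ∀ x : A.H1, 0 ≤ (D x x).re) (x : A.H1) :
    alpha D * ‖A.emb (A.incl x)‖ ^ 2 ≤ (D x x).re :=
  iInf_div_mul_le hD (N := fun x => ‖A.emb (A.incl x)‖) (by simp [norm_emb]) x

/-- A real infimum over the empty type is 0. -/
theorem nontrivial_of_delta_pos (hδ : 0 < delta D) : Nonempty {x : A.H1 // x ≠ 0} := by
  by_contra h
  rw [not_nonempty_iff] at h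
  rw [delta, Real.iInf_of_isEmpty] at hδ
  exact lt_irrefl _ hδ

/-- Since N is dominated by M‖·‖₁, each quotient is at least δ/M². -/
theorem iInf_div_pos (hD : ∀ x : A.H1, 0 ≤ (D x x).re) (hδ : 0 < delta D) {N : A.H1 → ℝ} {M : ℝ}
    (hN : ∀ x, x ≠ 0 → 0 < N x) (hM : ∀ x, N x ≤ M * ‖x‖) :
    0 < ⨅ x : {x : A.H1 // x ≠ 0}, (D x.1 x.1).re / N x.1 ^ 2 := by
  have := nontrivial_of_delta_pos hδ
  obtain ⟨x₀, hx₀⟩ := id this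
  have hM0 : 0 < M := by
    have := (hN x₀ hx₀).trans_le (hM x₀)
    exact pos_of_mul_pos_left this (norm_nonneg _)
  refine lt_of_lt_of_le (by positivity : 0 < delta D / M ^ 2) (le_ciInf fun x => ?_)
  have hx := hN x.1 x.2
  rw [div_le_div_iff₀ (by positivity) (by positivity)]
  calc delta D * N x.1 ^ 2 ≤ delta D * (M * ‖x.1‖) ^ 2 := by gcongr; exact hM x.1
    _ = delta D * ‖x.1‖ ^ 2 * M ^ 2 := by ring
    _ ≤ (D x.1 x.1).re * M ^ 2 := by gcongr; exact delta_mul_le hD x.1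

theorem incl_ne_zero {x : A.H1} (hx : x ≠ 0) : A.incl x ≠ 0 := fun h =>
  hx (incl_injective (h.trans (map_zero _).symm))

theorem beta_pos (hD : ∀ x : A.H1, 0 ≤ (D x x).re) (hδ : 0 < delta D) : 0 < beta D :=
  iInf_div_pos hD hδ (N := fun x => ‖A.incl x‖) (fun _ hx => norm_pos_iff.2 (incl_ne_zero hx))
    A.incl.le_opNorm

theorem alpha_pos (hD : ∀ x : A.H1, 0 ≤ (D x x).re) (hδ : 0 < delta D) : 0 < alpha D :=
  iInf_div_pos hD hδ (N := fun x => ‖A.emb (A.incl x)‖) (M := ‖A.sqrtInv‖ * ‖A.incl‖)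
    (fun _ hx => norm_pos_iff.2 fun h => incl_ne_zero hx (emb_injective _ h)) fun x => by
      rw [norm_emb, mul_assoc]
      exact (A.sqrtInv.le_opNorm _).trans
        (mul_le_mul_of_nonneg_left (A.incl.le_opNorm x) (norm_nonneg _))

theorem sqrt_mul_norm_le {a N r : ℝ} (ha : 0 ≤ a) (h : a * N ^ 2 ≤ r) : √a * N ≤ √r :=
  Real.le_sqrt_of_sq_le (by rwa [mul_pow, Real.sq_sqrt ha])

/-- Interpolation ‖x‖² ≤ ‖x‖₋₁‖x‖₁. It supplies the hypothesis b ≤ c of `mul_sq_le_sub_of_rate`. -/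
theorem sqrt_alpha_mul_delta_le_beta (hD : ∀ x : A.H1, 0 ≤ (D x x).re) (hδ : 0 < delta D) :
    √(alpha D * delta D) ≤ beta D := by
  have := nontrivial_of_delta_pos hδ
  have hα := alpha_pos hD hδ
  refine le_ciInf fun x => ?_
  have hx : 0 < ‖A.incl x.1‖ := norm_pos_iff.2 (incl_ne_zero x.2)
  rw [le_div_iff₀ (by positivity), Real.sqrt_mul hα.le]
  calc √(alpha D) * √(delta D) * ‖A.incl x.1‖ ^ 2
      ≤ √(alpha D) * √(delta D) * (‖A.emb (A.incl x.1)‖ * ‖x.1‖) := by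
        gcongr; exact norm_incl_sq_le x.1
    _ = (√(alpha D) * ‖A.emb (A.incl x.1)‖) * (√(delta D) * ‖x.1‖) := by ring
    _ ≤ √(D x.1 x.1).re * √(D x.1 x.1).re :=
        mul_le_mul (sqrt_mul_norm_le hα.le (alpha_mul_le hD x.1))
          (sqrt_mul_norm_le hδ.le (delta_mul_le hD x.1)) (by positivity) (by positivity)
    _ = _ := Real.mul_self_sqrt (hD x.1)

theorem norm_apply_le (x y : A.H1) : ‖D x y‖ ≤ ‖D‖ * ‖x‖ * ‖y‖ :=
  D.le_opNorm₂ x y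

theorem delta_le_norm (hD : ∀ x : A.H1, 0 ≤ (D x x).re) (hδ : 0 < delta D) : delta D ≤ ‖D‖ := by
  obtain ⟨x, hx⟩ := nontrivial_of_delta_pos hδ
  have h1 := delta_mul_le hD x
  have h2 := (Complex.re_le_norm _).trans (norm_apply_le (D := D) x x)
  have hx' : 0 < ‖x‖ := norm_pos_iff.2 hx
  have : delta D * ‖x‖ ^ 2 ≤ ‖D‖ * ‖x‖ ^ 2 := by nlinarith
  exact le_of_mul_le_mul_right this (by positivity)

/-! ### The decay rate and the modified energy. -/

theorem inv_decayRate (hδ : 0 < delta D) :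
    (decayRate D)⁻¹ = 1 / beta D + 2 * (1 / √(alpha D * delta D)) + ‖D‖ ^ 2 / delta D / 2 +
      √(4 * (‖D‖ ^ 2 / delta D) * (1 / √(alpha D * delta D)) + (‖D‖ ^ 2 / delta D) ^ 2) := by
  rw [decayRate, inv_inv]
  congr 1
  · congr 1
    · ring
    · field_simp
  · congr 2
    · ring
    · field_simp

theorem decayRate_pos (hD : ∀ x : A.H1, 0 ≤ (D x x).re) (hδ : 0 < delta D) : 0 < decayRate D := by
  have hα := alpha_pos hD hδ
  have hβ := beta_pos hD hδ
  have : 0 ≤ √(4 * ‖D‖ ^ 2 / (delta D * √(alpha D * delta D)) + ‖D‖ ^ 4 / delta D ^ 2) :=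
    Real.sqrt_nonneg _
  rw [decayRate, inv_pos]
  positivity

/-- The dissipation inequality for the modified energy. -/
theorem dissipation_nonpos (hD : ∀ x : A.H1, 0 ≤ (D x x).re) (hδ : 0 < delta D) (u v : A.H1) :
    -(D v v).re + 3 * decayRate D * ‖A.incl v‖ ^ 2 - decayRate D * ‖u‖ ^ 2
      - 2 * decayRate D * (D v u).re
      + 4 * decayRate D ^ 2 * (⟪A.incl u, A.incl v⟫_ℂ).re ≤ 0 := by
  have hα := alpha_pos hD hδ
  have hβ := beta_pos hD hδ
  have hω := decayRate_pos hD hδ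
  have hDpos : 0 < ‖D‖ := hδ.trans_le (delta_le_norm hD hδ)
  have hrate := mul_sq_le_sub_of_rate (b := 1 / beta D) (c := 1 / √(alpha D * delta D))
    (K := ‖D‖ ^ 2 / delta D) (by positivity)
    (one_div_le_one_div_of_le (by positivity) (sqrt_alpha_mul_delta_le_beta hD hδ))
    (by positivity) (inv_decayRate hδ)
  set ω := decayRate D
  set b := 1 / beta D with hb
  set c := 1 / √(alpha D * delta D) with hc
  set k := ‖D‖ / √(delta D) with hk
  have hsδ : 0 < √(delta D) := Real.sqrt_pos.2 hδ
  have hsα : 0 < √(alpha D) := Real.sqrt_pos.2 hα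
  have hk2 : ‖D‖ ^ 2 / delta D = k ^ 2 := by rw [hk, div_pow, Real.sq_sqrt hδ.le]
  rw [hk2, div_inv_eq_mul] at hrate
  set s := √(D v v).re with hs
  have hs0 : 0 ≤ s := Real.sqrt_nonneg _
  have hs2 : s ^ 2 = (D v v).re := Real.sq_sqrt (hD v)
  have hk0 : 0 < k := by positivity
  have hc0 : 0 < c := by positivity
  have hv : ‖A.incl v‖ ^ 2 ≤ b * s ^ 2 := by
    rw [hs2, hb, one_div, ← div_eq_inv_mul, le_div_iff₀ hβ, mul_comm]
    exact beta_mul_le hD v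
  have h1 : -(D v u).re ≤ k * s * ‖u‖ := by
    have h := sqrt_mul_norm_le hδ.le (delta_mul_le hD v)
    refine (neg_le_abs _).trans ((Complex.abs_re_le_norm _).trans ((norm_apply_le v u).trans ?_))
    refine mul_le_mul_of_nonneg_right ?_ (norm_nonneg _)
    have e : ‖D‖ * ‖v‖ = k * (√(delta D) * ‖v‖) := by rw [hk]; field_simp
    rw [e]
    exact mul_le_mul_of_nonneg_left h hk0.le
  have h2 : (⟪A.incl u, A.incl v⟫_ℂ).re ≤ c * k * s * ‖u‖ := by
    have h := sqrt_mul_norm_le hα.le (alpha_mul_le hD v)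
    refine (Complex.re_le_norm _).trans ((norm_inner_incl_le _ _).trans ?_)
    refine mul_le_mul_of_nonneg_right ?_ (norm_nonneg _)
    have e : ‖A.emb (A.incl v)‖ = c * √(delta D) * (√(alpha D) * ‖A.emb (A.incl v)‖) := by
      rw [hc, Real.sqrt_mul hα.le]; field_simp
    -- The natural bound has √δ in place of k; enlarging it to k gives both cross terms the common
    -- factor k.
    have hle : √(delta D) ≤ k := by
      rw [hk, le_div_iff₀ hsδ, Real.mul_self_sqrt hδ.le]
      exact delta_le_norm hD hδ
    rw [e]
    exact mul_le_mul (mul_le_mul_of_nonneg_left hle hc0.le) h (by positivity) (by positivity)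
  -- The cross terms add up to at most 2ωPs‖u‖₁, so completing the square leaves only ωP² ≤ 1 - 3ωb,
  -- which is `hrate` multiplied by ω.
  set P := k * (1 + 2 * c * ω) with hP
  have h3 : ω * P ^ 2 ≤ 1 - 3 * ω * b := by
    have := mul_le_mul_of_nonneg_left hrate hω.le
    rw [mul_sub, mul_inv_cancel₀ hω.ne'] at this
    rw [hP, mul_pow]
    linarith
  rw [← hs2]
  have h4 := mul_le_mul_of_nonneg_left hv hω.le
  have h5 := mul_le_mul_of_nonneg_left h1 hω.le
  have h6 := mul_le_mul_of_nonneg_left h2 (sq_nonneg ω)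
  have h7 := mul_le_mul_of_nonneg_right h3 (sq_nonneg s)
  have h8 : 0 ≤ ω * (P * s - ‖u‖) ^ 2 := by positivity
  have h9 : ω * (P * s - ‖u‖) ^ 2 =
    ω * P ^ 2 * s ^ 2 - 2 * (ω * (k * s * ‖u‖)) - 4 * (ω ^ 2 * (c * k * s * ‖u‖)) + ω * ‖u‖ ^ 2 := by
      rw [hP]; ring
  linarith

/-- The correction term of the modified energy is dominated by the energy. -/
theorem abs_correction_le (hD : ∀ x : A.H1, 0 ≤ (D x x).re) (hδ : 0 < delta D) (u : A.H1) (w : H) :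
    |4 * decayRate D * (⟪A.incl u, w⟫_ℂ).re| ≤ (‖u‖ ^ 2 + ‖w‖ ^ 2) / 2 := by
  have hα := alpha_pos hD hδ
  have hβ := beta_pos hD hδ
  have hω := decayRate_pos hD hδ
  have hDpos : 0 < ‖D‖ := hδ.trans_le (delta_le_norm hD hδ)
  have hW := inv_decayRate hδ
  have hbc := one_div_le_one_div_of_le (by positivity) (sqrt_alpha_mul_delta_le_beta hD hδ)
  have hb0 : 0 < 1 / beta D := by positivity
  have hb : ‖A.incl u‖ ^ 2 ≤ 1 / beta D * (‖D‖ * ‖u‖ ^ 2) := by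
    rw [one_div, ← div_eq_inv_mul, le_div_iff₀ hβ, mul_comm]
    refine (beta_mul_le hD u).trans ((Complex.re_le_norm _).trans ((norm_apply_le u u).trans ?_))
    exact le_of_eq (by ring)
  have hDK : ‖D‖ ≤ ‖D‖ ^ 2 / delta D := by
    rw [le_div_iff₀ hδ, sq]
    exact mul_le_mul_of_nonneg_left (delta_le_norm hD hδ) hDpos.le
  have hq : ‖D‖ ≤ √(4 * (‖D‖ ^ 2 / delta D) * (1 / √(alpha D * delta D)) +
      (‖D‖ ^ 2 / delta D) ^ 2) := by
    refine Real.le_sqrt_of_sq_le ?_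
    have h : ‖D‖ ^ 2 ≤ (‖D‖ ^ 2 / delta D) ^ 2 := by gcongr
    have : 0 ≤ 4 * (‖D‖ ^ 2 / delta D) * (1 / √(alpha D * delta D)) := by positivity
    linarith
  set ω := decayRate D
  set b := 1 / beta D
  -- Uses c ≥ b, K ≥ ‖D‖ and the bound ‖D‖ on the square root. By the arithmetic–geometric mean
  -- inequality the square is at least 18b‖D‖.
  have hWle : 3 * b + 3 / 2 * ‖D‖ ≤ ω⁻¹ := by rw [hW]; linarith
  have hW2 : 16 * (b * ‖D‖) ≤ ω⁻¹ ^ 2 := by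
    have h := pow_le_pow_left₀ (by positivity) hWle 2
    nlinarith [sq_nonneg (2 * b - ‖D‖), mul_pos hb0 hDpos]
  have h1 : 4 * ω * ‖A.incl u‖ ≤ ‖u‖ := by
    refine (sq_le_sq₀ (by positivity) (norm_nonneg _)).1 ?_
    have h := mul_le_mul_of_nonneg_left hW2 (sq_nonneg ω)
    rw [← mul_pow, mul_inv_cancel₀ hω.ne', one_pow] at h
    calc (4 * ω * ‖A.incl u‖) ^ 2 = 16 * ω ^ 2 * ‖A.incl u‖ ^ 2 := by ring
      _ ≤ 16 * ω ^ 2 * (b * (‖D‖ * ‖u‖ ^ 2)) := by gcongr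
      _ = ω ^ 2 * (16 * (b * ‖D‖)) * ‖u‖ ^ 2 := by ring
      _ ≤ 1 * ‖u‖ ^ 2 := by gcongr
      _ = ‖u‖ ^ 2 := one_mul _
  rw [abs_mul, abs_of_pos (by positivity)]
  calc 4 * ω * |(⟪A.incl u, w⟫_ℂ).re| ≤ 4 * ω * (‖A.incl u‖ * ‖w‖) := by
        gcongr; exact (Complex.abs_re_le_norm _).trans (norm_inner_le_norm _ _)
    _ = (4 * ω * ‖A.incl u‖) * ‖w‖ := by ring
    _ ≤ ‖u‖ * ‖w‖ := by gcongr
    _ ≤ _ := by nlinarith [sq_nonneg (‖u‖ - ‖w‖)]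

/-- Exponential decay of the energy. -/
theorem energy_le (hD : ∀ x : A.H1, 0 ≤ (D x x).re) (hδ : 0 < delta D)
    {u v : ℝ → A.H1} {a : ℝ → H}
    (hu : ∀ t, 0 ≤ t → HasDerivWithinAt u (v t) (Ici 0) t)
    (hv : ∀ t, 0 ≤ t → HasDerivWithinAt (fun s => A.incl (v s)) (a t) (Ici 0) t)
    (heq : ∀ t, 0 ≤ t → A.emb (a t) + D (v t) + A.ext (u t) = 0) {t : ℝ} (ht : 0 ≤ t) :
    ‖u t‖ ^ 2 + ‖A.incl (v t)‖ ^ 2 ≤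
      3 * Real.exp (-2 * decayRate D * t) * (‖u 0‖ ^ 2 + ‖A.incl (v 0)‖ ^ 2) := by
  set ω := decayRate D with hω
  set F : ℝ → ℝ := fun s => (⟪u s, u s⟫_ℂ).re + (⟪A.incl (v s), A.incl (v s)⟫_ℂ).re +
    4 * ω * (⟪A.incl (u s), A.incl (v s)⟫_ℂ).re with hF
  have e1 : ∀ x : A.H1, (⟪x, x⟫_ℂ).re = ‖x‖ ^ 2 := fun x => inner_self_eq_norm_sq (𝕜 := ℂ) x
  have e2 : ∀ x : H, (⟪x, x⟫_ℂ).re = ‖x‖ ^ 2 := fun x => inner_self_eq_norm_sq (𝕜 := ℂ) x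
  have hdF : ∀ s, 0 ≤ s → HasDerivWithinAt F
      (-2 * (D (v s) (v s)).re + 4 * ω * ‖A.incl (v s)‖ ^ 2 - 4 * ω * (D (v s) (u s)).re
        - 4 * ω * ‖u s‖ ^ 2) (Ici 0) s := fun s hs => by
    have hi : HasDerivWithinAt (fun s => A.incl (u s)) (A.incl (v s)) (Ici 0) s :=
      (A.incl.restrictScalars ℝ).hasFDerivAt.comp_hasDerivWithinAt s (hu s hs)
    have d1 := Complex.reCLM.hasFDerivAt.comp_hasDerivWithinAt s ((hu s hs).inner ℂ (hu s hs))
    have d2 := Complex.reCLM.hasFDerivAt.comp_hasDerivWithinAt s ((hv s hs).inner ℂ (hv s hs))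
    have d3 := Complex.reCLM.hasFDerivAt.comp_hasDerivWithinAt s (hi.inner ℂ (hv s hs))
    refine ((d1.add d2).add (d3.const_mul (4 * ω))).congr_deriv ?_
    -- Pairing with v and with u eliminates the acceleration from F'.
    have q : ∀ y : A.H1, ⟪A.incl y, a s⟫_ℂ + D (v s) y + ⟪y, u s⟫_ℂ = 0 := fun y =>
      congrArg (fun f : A.Hm1 => f y) (heq s hs)
    have q1 := congrArg Complex.re (q (v s))
    have q2 := congrArg Complex.re (q (u s))
    simp only [Complex.add_re, Complex.zero_re, e1] at q1 q2
    have c1 : (⟪u s, v s⟫_ℂ).re = (⟪v s, u s⟫_ℂ).re := by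
      rw [← inner_conj_symm, Complex.conj_re]
    have c2 : (⟪a s, A.incl (v s)⟫_ℂ).re = (⟪A.incl (v s), a s⟫_ℂ).re := by
      rw [← inner_conj_symm, Complex.conj_re]
    simp only [Complex.reCLM_apply, Complex.add_re, e2, c1, c2]
    linear_combination 2 * q1 + 4 * ω * q2
  have hdG : ∀ s, 0 ≤ s → HasDerivWithinAt (fun s => Real.exp (2 * ω * s) * F s)
      (Real.exp (2 * ω * s) * (2 * ω) * F s + Real.exp (2 * ω * s) *
        (-2 * (D (v s) (v s)).re + 4 * ω * ‖A.incl (v s)‖ ^ 2 - 4 * ω * (D (v s) (u s)).re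
        - 4 * ω * ‖u s‖ ^ 2)) (Ici 0) s := fun s hs => by
    have : HasDerivAt (fun s : ℝ => Real.exp (2 * ω * s)) (Real.exp (2 * ω * s) * (2 * ω)) s := by
      simpa using ((hasDerivAt_id s).const_mul (2 * ω)).exp
    exact this.hasDerivWithinAt.mul (hdF s hs)
  have hanti : AntitoneOn (fun s => Real.exp (2 * ω * s) * F s) (Ici 0) := by
    refine antitoneOn_of_deriv_nonpos (convex_Ici 0) (fun s hs => (hdG s hs).continuousWithinAt)
      (fun s hs => ?_) fun s hs => ?_
    all_goals rw [interior_Ici] at hs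
    · exact ((hdG s (le_of_lt hs)).hasDerivAt (Ici_mem_nhds hs)).differentiableAt.differentiableWithinAt
    · rw [((hdG s (le_of_lt hs)).hasDerivAt (Ici_mem_nhds hs)).deriv]
      have h := dissipation_nonpos hD hδ (u s) (v s)
      rw [← hω] at h
      have e : Real.exp (2 * ω * s) * (2 * ω) * F s + Real.exp (2 * ω * s) *
          (-2 * (D (v s) (v s)).re + 4 * ω * ‖A.incl (v s)‖ ^ 2 - 4 * ω * (D (v s) (u s)).re
          - 4 * ω * ‖u s‖ ^ 2) = Real.exp (2 * ω * s) * 2 * (-(D (v s) (v s)).re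
          + 3 * ω * ‖A.incl (v s)‖ ^ 2 - ω * ‖u s‖ ^ 2 - 2 * ω * (D (v s) (u s)).re
          + 4 * ω ^ 2 * (⟪A.incl (u s), A.incl (v s)⟫_ℂ).re) := by
        rw [hF]; simp only [e1, e2]; ring
      rw [e]
      exact mul_nonpos_of_nonneg_of_nonpos (by positivity) h
  have h := hanti self_mem_Ici ht ht
  simp only [mul_zero, Real.exp_zero, one_mul] at h
  have hFt : (‖u t‖ ^ 2 + ‖A.incl (v t)‖ ^ 2) / 2 ≤ F t := by
    have := (abs_le.1 (abs_correction_le hD hδ (u t) (A.incl (v t)))).1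
    rw [hF]; simp only [e1, e2]; linarith
  have hF0 : F 0 ≤ 3 / 2 * (‖u 0‖ ^ 2 + ‖A.incl (v 0)‖ ^ 2) := by
    have := (abs_le.1 (abs_correction_le hD hδ (u 0) (A.incl (v 0)))).2
    rw [hF]; simp only [e1, e2]; linarith
  have hexp : Real.exp (-2 * ω * t) * Real.exp (2 * ω * t) = 1 := by
    rw [← Real.exp_add, ← Real.exp_zero]; congr 1; ring
  have h' := mul_le_mul_of_nonneg_left (h.trans hF0) (Real.exp_nonneg (-2 * ω * t))
  rw [← mul_assoc, hexp, one_mul] at h'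
  linarith

end PosDefOperator

/-! ### Existence and uniqueness of classical solutions -/

namespace PosDefOperator

variable {H : Type*} [NormedAddCommGroup H] [InnerProductSpace ℂ H] [CompleteSpace H]
  {A : PosDefOperator H} {D : A.H1 →L[ℂ] A.Hm1}

/-! ### The Riesz isomorphism and the inverse operator matrix. -/

instance : CompleteSpace A.H1 :=
  (completeSpace_congr (e := A.sqrt.toEquiv)
    (LinearIsometry.isometry ⟨A.sqrt.toLinearMap, fun _ => rfl⟩).isUniformEmbedding).2 inferInstance

theorem ext_bijective : Function.Bijective A.ext := by
  refine ⟨(injective_iff_map_eq_zero A.ext).2 fun x hx => ?_, fun φ => ?_⟩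
  · have h : ⟪x, x⟫_ℂ = 0 := congrArg (fun f : A.Hm1 => f x) hx
    exact inner_self_eq_zero.1 h
  -- Riesz representation applies to linear functionals, so the conjugate-linear φ is conjugated
  -- first.
  · let ψ : A.H1 →L[ℂ] ℂ := ((starL ℂ : ℂ ≃L⋆[ℂ] ℂ) : ℂ →L⋆[ℂ] ℂ).comp φ
    refine ⟨(InnerProductSpace.toDual ℂ A.H1).symm ψ, ContinuousLinearMap.ext fun y => ?_⟩
    have h : ⟪(InnerProductSpace.toDual ℂ A.H1).symm ψ, y⟫_ℂ = ψ y :=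
      InnerProductSpace.toDual_symm_apply
    change ⟪y, (InnerProductSpace.toDual ℂ A.H1).symm ψ⟫_ℂ = φ y
    rw [← inner_conj_symm, h]
    exact star_star (φ y)

variable (A) in
/-- `A : H₁ → H₋₁` as a continuous linear equivalence. -/
noncomputable def extEquiv : A.H1 ≃L[ℂ] A.Hm1 :=
  ContinuousLinearEquiv.ofBijective A.ext (LinearMap.ker_eq_bot.2 ext_bijective.1)
    (LinearMap.range_eq_top.2 ext_bijective.2)

theorem ext_extEquiv_symm (φ : A.Hm1) : A.ext (A.extEquiv.symm φ) = φ :=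
  A.extEquiv.apply_symm_apply φ

variable (A) in
/-- The embedding of `H` into `H₋₁` as a continuous linear map. -/
noncomputable def embL : H →L[ℂ] A.Hm1 :=
  LinearMap.mkContinuous
    { toFun := A.emb
      map_add' := fun x y => ContinuousLinearMap.ext fun z => by simp [emb_apply]
      map_smul' := fun c x => ContinuousLinearMap.ext fun z => by simp [emb_apply] } ‖A.sqrtInv‖ fun x =>
    (A.norm_emb x).trans_le (A.sqrtInv.le_opNorm x)

theorem embL_apply (h : H) : A.embL h = A.emb h := rfl

variable (D) in
/-- The inverse of the operator matrix `(-D, -A; I, 0)` in the energy space. -/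
noncomputable def matrixInv : WithLp 2 (H × A.H1) →L[ℂ] WithLp 2 (H × A.H1) :=
  ((WithLp.prodContinuousLinearEquiv 2 ℂ H A.H1).symm : H × A.H1 →L[ℂ] WithLp 2 (H × A.H1)).comp
    (((A.incl.comp (ContinuousLinearMap.snd ℂ H A.H1)).prod
      (-((A.extEquiv.symm : A.Hm1 →L[ℂ] A.H1).comp (A.embL.coprod D)))).comp
      ((WithLp.prodContinuousLinearEquiv 2 ℂ H A.H1) : WithLp 2 (H × A.H1) →L[ℂ] H × A.H1))

theorem matrixInv_fst (z : WithLp 2 (H × A.H1)) : (matrixInv D z).fst = A.incl z.snd := rfl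

theorem matrixInv_snd (z : WithLp 2 (H × A.H1)) :
    (matrixInv D z).snd = -A.extEquiv.symm (A.emb z.fst + D z.snd) := rfl

theorem ext_matrixInv_snd (z : WithLp 2 (H × A.H1)) :
    A.ext (matrixInv D z).snd = -(A.emb z.fst + D z.snd) := by
  rw [matrixInv_snd, map_neg, ext_extEquiv_symm]

/-- The two pairings of the components of z cancel in the real part, leaving -Re(Dz₂, z₂). -/
theorem re_inner_matrixInv_nonpos (hD : ∀ x : A.H1, 0 ≤ (D x x).re) (z : WithLp 2 (H × A.H1)) :
    (⟪matrixInv D z, z⟫_ℂ).re ≤ 0 := by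
  have h : ⟪z.snd, (matrixInv D z).snd⟫_ℂ = -(⟪A.incl z.snd, z.fst⟫_ℂ + D z.snd z.snd) :=
    congrArg (fun f : A.Hm1 => f z.snd) (ext_matrixInv_snd z)
  have e : (⟪matrixInv D z, z⟫_ℂ).re = -(D z.snd z.snd).re := by
    change (⟪A.incl z.snd, z.fst⟫_ℂ + ⟪(matrixInv D z).snd, z.snd⟫_ℂ).re = _
    rw [← inner_conj_symm (matrixInv D z).snd, h, Complex.add_re, Complex.conj_re,
      Complex.neg_re, Complex.add_re]
    have : (⟪z.fst, A.incl z.snd⟫_ℂ).re = (⟪A.incl z.snd, z.fst⟫_ℂ).re := by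
      rw [← inner_conj_symm, Complex.conj_re]
    linarith
  rw [e]
  exact neg_nonpos.2 (hD _)

theorem matrixInv_injective : Function.Injective (matrixInv D) := by
  refine (injective_iff_map_eq_zero _).2 fun z hz => ?_
  have h1 : A.incl z.snd = 0 := by rw [← matrixInv_fst (D := D), hz]; rfl
  have h2 : z.snd = 0 := incl_injective (h1.trans (map_zero _).symm)
  have h3 := ext_matrixInv_snd (D := D) z
  have h4 : (matrixInv D z).snd = 0 := by rw [hz]; rfl
  rw [h4, h2, map_zero, map_zero, add_zero, zero_eq_neg] at h3
  have h5 := emb_injective _ h3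
  exact WithLp.ofLp_injective 2 (Prod.ext h5 h2)

/-! ### Classical solutions. -/

theorem velocity_eq {u : ℝ → A.H1} {v : A.H1} {t : ℝ} (ht : 0 ≤ t)
    (h : HasDerivWithinAt u v (Ici 0) t) : velocity u t = v :=
  h.derivWithin (uniqueDiffOn_Ici 0 t ht)

theorem exists_isSolution (hD : ∀ x : A.H1, 0 ≤ (D x x).re) {u₁ u₀ : A.H1}
    (h : (u₁, u₀) ∈ domT D) : ∃ u, IsSolution D u₁ u₀ u := by
  obtain ⟨f, hf⟩ := h
  -- The initial value is T(u₁, u₀) = (-f, u₁), so that w(0) = Jz(0) = (u₁, u₀).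
  obtain ⟨z, w, hz, hz0, hw, hwz⟩ := DissipativeInverse.exists_hasDerivAt
    (re_inner_matrixInv_nonpos hD) matrixInv_injective (WithLp.toLp 2 (-f, u₁))
  have hz1 : Continuous fun t => (z t).fst := (WithLp.fstL 2 ℂ H A.H1).continuous.comp hz
  have hz2 : Continuous fun t => (z t).snd := (WithLp.sndL 2 ℂ H A.H1).continuous.comp hz
  have hw1 : ∀ t, HasDerivAt (fun s => (w s).fst) (z t).fst t := fun t =>
    ((WithLp.fstL 2 ℂ H A.H1).restrictScalars ℝ).hasFDerivAt.comp_hasDerivAt t (hw t)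
  have hw2 : ∀ t, HasDerivAt (fun s => (w s).snd) (z t).snd t := fun t =>
    ((WithLp.sndL 2 ℂ H A.H1).restrictScalars ℝ).hasFDerivAt.comp_hasDerivAt t (hw t)
  have hvel : ∀ t, 0 ≤ t → velocity (fun s => (w s).snd) t = (z t).snd := fun t ht =>
    velocity_eq ht (hw2 t).hasDerivWithinAt
  have hincl : ∀ t, 0 ≤ t → A.incl (velocity (fun s => (w s).snd) t) = (w t).fst := fun t ht => by
    rw [hvel t ht, hwz t ht, matrixInv_fst]
  have hd : ∀ t, 0 ≤ t → HasDerivWithinAt (fun s => A.incl (velocity (fun s => (w s).snd) s))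
      (z t).fst (Ici 0) t := fun t ht =>
    (hw1 t).hasDerivWithinAt.congr (fun s hs => hincl s hs) (hincl t ht)
  have hacc : ∀ t, 0 ≤ t → acceleration (fun s => (w s).snd) t = (z t).fst := fun t ht =>
    (hd t ht).derivWithin (uniqueDiffOn_Ici 0 t ht)
  refine ⟨fun t => (w t).snd, ?_, ?_, fun t ht => ?_, ?_, ?_⟩
  · exact (contDiffOn_one_iff_derivWithin (uniqueDiffOn_Ici 0)).2
      ⟨fun t _ => (hw2 t).differentiableAt.differentiableWithinAt,
        hz2.continuousOn.congr fun t ht => hvel t ht⟩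
  · exact (contDiffOn_one_iff_derivWithin (uniqueDiffOn_Ici 0)).2
      ⟨fun t ht => (hd t ht).differentiableWithinAt,
        hz1.continuousOn.congr fun t ht => hacc t ht⟩
  · rw [hvel t ht, hacc t ht, hwz t ht, ext_matrixInv_snd, add_neg_cancel]
  · rw [hwz 0 le_rfl, hz0]
    refine ext_bijective.1 ?_
    rw [ext_matrixInv_snd]
    change -(A.emb (-f) + D u₁) = _
    have e : A.emb (-f) = -A.emb f := map_neg A.embL f
    rw [e, ← hf]
    abel
  · exact (hvel 0 le_rfl).trans (congrArg WithLp.snd hz0)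

theorem IsSolution.hasDerivWithinAt {u₁ u₀ : A.H1} {u : ℝ → A.H1} (h : IsSolution D u₁ u₀ u)
    {t : ℝ} (ht : 0 ≤ t) : HasDerivWithinAt u (velocity u t) (Ici 0) t :=
  (h.contDiffOn.differentiableOn one_ne_zero t ht).hasDerivWithinAt

theorem IsSolution.hasDerivWithinAt_velocity {u₁ u₀ : A.H1} {u : ℝ → A.H1}
    (h : IsSolution D u₁ u₀ u) {t : ℝ} (ht : 0 ≤ t) :
    HasDerivWithinAt (fun s => A.incl (velocity u s)) (acceleration u t) (Ici 0) t :=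
  (h.contDiffOn_velocity.differentiableOn one_ne_zero t ht).hasDerivWithinAt

theorem IsSolution.eqOn (hD : ∀ x : A.H1, 0 ≤ (D x x).re) (hδ : 0 < delta D) {u₁ u₀ : A.H1}
    {u v : ℝ → A.H1} (hv : IsSolution D u₁ u₀ v) (hu : IsSolution D u₁ u₀ u) :
    EqOn v u (Ici 0) := fun t ht => by
  have h := energy_le hD hδ (u := fun s => v s - u s) (v := fun s => velocity v s - velocity u s)
    (a := fun s => acceleration v s - acceleration u s)
    (fun s hs => (hv.hasDerivWithinAt hs).sub (hu.hasDerivWithinAt hs))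
    (fun s hs => by
      simpa only [map_sub] using
        (hv.hasDerivWithinAt_velocity hs).fun_sub (hu.hasDerivWithinAt_velocity hs))
    (fun s hs => by
      rw [← embL_apply, map_sub, map_sub, map_sub, embL_apply, embL_apply]
      have e := congrArg₂ (· - ·) (hv.equation s hs) (hu.equation s hs)
      simp only [sub_zero] at e
      rw [← e]
      abel) ht
  simp only [hv.initial_position, hu.initial_position, hv.initial_velocity, hu.initial_velocity,
    sub_self, map_zero, norm_zero] at h
  have h0 : ‖v t - u t‖ ^ 2 ≤ 0 := by
    nlinarith [sq_nonneg ‖A.incl (velocity v t - velocity u t)‖]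
  exact sub_eq_zero.1 (norm_eq_zero.1 (pow_eq_zero_iff two_ne_zero |>.1
    (le_antisymm h0 (sq_nonneg _))))

end PosDefOperator

theorem corollary3 {H : Type*} [NormedAddCommGroup H] [InnerProductSpace ℂ H] [CompleteSpace H]
    (A : PosDefOperator H) (D : A.H1 →L[ℂ] A.Hm1)
    (hD : PosDefOperator.IsAccretiveSectorial D) (hδ : 0 < PosDefOperator.delta D) :
    0 < PosDefOperator.decayRate D ∧
    ∃ C : ℝ, 0 < C ∧ ∀ u₁ u₀ : A.H1, (u₁, u₀) ∈ PosDefOperator.domT D →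
      ∃ u : ℝ → A.H1, PosDefOperator.IsSolution D u₁ u₀ u ∧
        (∀ v : ℝ → A.H1, PosDefOperator.IsSolution D u₁ u₀ v → Set.EqOn v u (Set.Ici 0)) ∧
        ∀ t : ℝ, 0 ≤ t →
          ‖u t‖ ^ 2 + ‖A.incl (PosDefOperator.velocity u t)‖ ^ 2 ≤
            C * Real.exp (-2 * PosDefOperator.decayRate D * t) *
              (‖u₀‖ ^ 2 + ‖A.incl u₁‖ ^ 2) := by
  refine ⟨PosDefOperator.decayRate_pos hD.1 hδ, 3, by norm_num, fun u₁ u₀ h => ?_⟩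
  obtain ⟨u, hu⟩ := PosDefOperator.exists_isSolution hD.1 h
  refine ⟨u, hu, fun v hv => hv.eqOn hD.1 hδ hu, fun t ht => ?_⟩
  have := PosDefOperator.energy_le hD.1 hδ (fun _ hs => hu.hasDerivWithinAt hs)
    (fun _ hs => hu.hasDerivWithinAt_velocity hs) hu.equation ht
  rwa [hu.initial_position, hu.initial_velocity] at this
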